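/- **Theorem (Compactness of ${\sf QBD2}$).** Let ${\bf 4}=\{1,{\bf b},{\bf n},0\}$ be the four-element lattice with bottom $0$, top $1$ and incomparable ${\bf b},{\bf n}$, and let $\wedge,\vee$ be its meet and join. Define $\neg 1=0$, $\neg{\bf b}={\bf b}$, $\neg{\bf n}={\bf n}$, $\neg 0=1$; $\circ 1=1$, $\circ{\bf b}=0$, $\circ{\bf n}={\bf b}$, $\circ 0=1$ (where $\circ$ denotes the weak consistency operator); and $1\to y={\bf b}\to y=y$, $0\to y=1$, ${\bf n}\to 1={\bf n}\to{\bf n}=1$, ${\bf n}\to{\bf b}={\bf n}\to 0={\bf b}$. The designated values are $1$ and ${\bf b}$. Let $\mathcal S$ be a first-order signature consisting of arbitrary sets of predicate symbols, function symbols (each with a finite arity) and constant symbols, and let ${\rm For}(\mathcal S)$ be the set of first-order formulas (without built-in equality), possibly with free variables, built from a denumerable set $\mathcal V$ of variables with $\wedge,\vee,\to,\neg,\circ,\forall,\exists$. A ${\sf QBD2}$-structure $\mathfrak A$ has a non-empty domain $A$, and interprets each $n$-ary predicate symbol as a map $A^n\to{\bf 4}$, each $n$-ary function symbol as a map $A^n\to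 A$ and each constant symbol as an element of $A$. For an assignment $s:\mathcal V\to A$, the value $\|\varphi\|^{\mathfrak A}(s)\in{\bf 4}$ is defined recursively: an atomic formula $P(t_1,\dots,t_n)$ has the value $P^{\mathfrak A}(t_1^{\mathfrak A}[s],\dots,t_n^{\mathfrak A}[s])$, the connectives are interpreted by the operations above, $\|\forall x\,\varphi\|^{\mathfrak A}(s)=\inf_{a\in A}\|\varphi\|^{\mathfrak A}(s_x^a)$ and $\|\exists x\,\varphi\|^{\mathfrak A}(s)=\sup_{a\in A}\|\varphi\|^{\mathfrak A}(s_x^a)$, where $s_x^a$ agrees with $s$ except that it sends $x$ to $a$. The structure $\mathfrak A$ is a model of $\varphi$ if $\|\varphi\|^{\mathfrak A}(s)\in\{1,{\bf b}\}$ for every assignment $s$, and a model of a set of formulas if it is a model of each of its members. Write $\Delta\models_{\sf QBD2}\varphi$ if every model of $\Delta$ is a model of $\varphi$. Let $\Delta\cup\{\varphi\}\subseteq{\rm For}(\mathcal S)$. If $\Delta\models_{\sf QBD2}\varphi$, then there is a finite set $\Delta_0\subseteq\Delta$ such that $\Delta_0\models_{\sf QBD2}\varphi$. -/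

import Mathlib

universe u w

namespace QBD2

/-- The four truth values `1`, `b` (both), `n` (neither), `0`. -/
inductive Four : Type
  | one
  | b
  | n
  | zero
  deriving DecidableEq

namespace Four

instance : Fintype Four where
  elems := {one, b, n, zero}
  complete x := by cases x <;> decide

/-- Conjunction table of the four-element De Morgan algebra `DM4`. -/
def and : Four → Four → Four
  | one, y => y
  | x, one => x
  | b, b => b
  | n, n => n
  | _, _ => zero

/-- Disjunction table of `DM4`. -/
def or : Four → Four → Four
  | zero, y => y
  | x, zero => x
  | b, b => b
  | n, n => n
  | _, _ => one

/-- De Morgan negation. -/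
def neg : Four → Four
  | one => zero
  | b => b
  | n => n
  | zero => one

/-- Implication table of `BD2`. -/
def imp : Four → Four → Four
  | one, y => y
  | b, y => y
  | n, one => one
  | n, b => b
  | n, n => one
  | n, zero => b
  | zero, _ => one

/-- The weak consistency operator of `BD2`. -/
def cons : Four → Four
  | one => one
  | b => zero
  | n => b
  | zero => one

/-- The designated values `1` and `b`. -/
def designated : Set Four := {one, b}

instance : Min Four := ⟨Four.and⟩

instance : Max Four := ⟨Four.or⟩

/-- The lattice order of `DM4` (`x ≤ y` iff `x ∨ y = y`): `0` is the bottom, `1` is the top, and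
`b`, `n` are incomparable. -/
instance : Lattice Four :=
  Lattice.mk' (by decide) (by decide) (by decide) (by decide) (by decide) (by decide)

instance : BoundedOrder Four where
  top := one
  bot := zero
  le_top x := sup_eq_right.mp (by revert x; decide)
  bot_le x := sup_eq_right.mp (by revert x; decide)

/-- A finite lattice is complete; this supplies the infima and suprema used for the quantifiers. -/
noncomputable instance : CompleteLattice Four := Fintype.toCompleteLattice Four

end Four

/-- A first-order signature: predicate symbols and function symbols with arities, and constant
symbols. -/
structure Signature where
  Pred : Type u
  predArity : Pred → ℕ
  Func : Type u
  funcArity : Func → ℕ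
  Const : Type u

/-- Terms; the denumerable set of individual variables is `ℕ`. -/
inductive Term (S : Signature.{u}) : Type u
  | var (x : ℕ) : Term S
  | const (c : S.Const) : Term S
  | func (f : S.Func) (ts : Fin (S.funcArity f) → Term S) : Term S

/-- Formulas over the connectives `∧, ∨, →, ¬`, the consistency operator, and both quantifiers. -/
inductive Formula (S : Signature.{u}) : Type u
  | pred (P : S.Pred) (ts : Fin (S.predArity P) → Term S) : Formula S
  | neg (φ : Formula S) : Formula S
  | cons (φ : Formula S) : Formula S
  | and (φ ψ : Formula S) : Formula S
  | or (φ ψ : Formula S) : Formula S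
  | imp (φ ψ : Formula S) : Formula S
  | all (x : ℕ) (φ : Formula S) : Formula S
  | ex (x : ℕ) (φ : Formula S) : Formula S

/-- A `4`-structure: a non-empty domain, four-valued predicates, total functions, constants. -/
structure Structure (S : Signature.{u}) where
  Dom : Type w
  nonempty : Nonempty Dom
  pred : (P : S.Pred) → (Fin (S.predArity P) → Dom) → Four
  func : (f : S.Func) → (Fin (S.funcArity f) → Dom) → Dom
  const : S.Const → Dom

namespace Structure

/-- The value of a term under an assignment. -/
def termVal {S : Signature.{u}} (A : Structure.{u, w} S) (s : ℕ → A.Dom) : Term S → A.Dom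
  | .var x => s x
  | .const c => A.const c
  | .func f ts => A.func f (fun i => A.termVal s (ts i))

/-- The truth value of a formula under an assignment. -/
noncomputable def val {S : Signature.{u}} (A : Structure.{u, w} S) :
    Formula S → (ℕ → A.Dom) → Four
  | .pred P ts, s => A.pred P (fun i => A.termVal s (ts i))
  | .neg φ, s => (A.val φ s).neg
  | .cons φ, s => (A.val φ s).cons
  | .and φ ψ, s => (A.val φ s).and (A.val ψ s)
  | .or φ ψ, s => (A.val φ s).or (A.val ψ s)
  | .imp φ ψ, s => (A.val φ s).imp (A.val ψ s)
  | .all x φ, s => sInf {v | ∃ a : A.Dom, v = A.val φ (Function.update s x a)}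
  | .ex x φ, s => sSup {v | ∃ a : A.Dom, v = A.val φ (Function.update s x a)}

/-- The assignment `s` satisfies `φ` in `A`. -/
def Satisfies {S : Signature.{u}} (A : Structure.{u, w} S) (s : ℕ → A.Dom) (φ : Formula S) :
    Prop :=
  A.val φ s ∈ Four.designated

/-- `A` is a model of the formula `φ`: every assignment satisfies `φ`. -/
def IsModel {S : Signature.{u}} (A : Structure.{u, w} S) (φ : Formula S) : Prop :=
  ∀ s : ℕ → A.Dom, A.Satisfies s φ

end Structure

/-- Semantic consequence: every model of all formulas in `Δ` is a model of `φ`. The domains range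
over a universe that is at least as large as that of the signature. -/
def Entails {S : Signature.{u}} (Δ : Set (Formula S)) (φ : Formula S) : Prop :=
  ∀ A : Structure.{u, max u w} S, (∀ γ ∈ Δ, A.IsModel γ) → A.IsModel φ

end QBD2

namespace QBD2

open Filter

universe v

/-! Compactness by ultraproducts. If no finite `F ⊆ Δ` entails `φ`, each `F` has a model `A F`
refuting `φ` at some `s F`. Along an ultrafilter containing every set `{F | γ ∈ F}` with `γ ∈ Δ`,
the ultraproduct is a model of `Δ` that refutes `φ` at the assignment assembled from the `s F`.
Łoś's theorem must track exact values: designation alone does not determine that of `¬` (compare `1`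
and `b`). Values converge because `Four` is finite, and connectives act pointwise. An infimum or
supremum in `Four` need not be attained (`b ∧ n = 0`), so for quantifiers the whole set of values is
shown to converge. -/

/-- Along an ultrafilter, a function with values in a finite type is eventually constant. -/
theorem exists_eventually_eq_of_finite {I : Type v} {α : Type*} [Finite α] (U : Ultrafilter I)
    (f : I → α) : ∃ c, ∀ᶠ i in U, f i = c :=
  Ultrafilter.eventually_exists_iff.mp (Eventually.of_forall fun i => ⟨f i, rfl⟩)

/-- The limit of a family of truth values along an ultrafilter. -/
noncomputable def ultraLim {I : Type v} (U : Ultrafilter I) (f : I → Four) : Four :=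
  (exists_eventually_eq_of_finite U f).choose

theorem eventually_eq_ultraLim {I : Type v} (U : Ultrafilter I) (f : I → Four) :
    ∀ᶠ i in U, f i = ultraLim U f :=
  (exists_eventually_eq_of_finite U f).choose_spec

namespace Structure

/-- The ultraproduct of a family of structures. Since the language has no equality, the domain is
the full product, without passing to the quotient by the ultrafilter. -/
noncomputable def ultraproduct {S : Signature.{u}} {I : Type v} (U : Ultrafilter I)
    (A : I → Structure.{u, w} S) : Structure.{u, max v w} S where
  Dom := ∀ i, (A i).Dom
  nonempty := ⟨fun i => (A i).nonempty.some⟩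
  pred P a := ultraLim U fun i => (A i).pred P fun k => a k i
  func f a := fun i => (A i).func f fun k => a k i
  const c := fun i => (A i).const c

section Ultraproduct

variable {S : Signature.{u}} {I : Type v} (U : Ultrafilter I) (A : I → Structure.{u, w} S)

theorem termVal_ultraproduct (s : ℕ → ∀ i, (A i).Dom) (t : Term S) (i : I) :
    (ultraproduct U A).termVal s t i = (A i).termVal (fun x => s x i) t := by
  induction t with
  | var x => rfl
  | const c => rfl
  | func f ts ih =>
    change (A i).func f (fun k => (ultraproduct U A).termVal s (ts k) i) = _
    simp only [ih, termVal]

theorem update_apply_coord (s : ℕ → ∀ i, (A i).Dom) (x : ℕ) (a : ∀ i, (A i).Dom) (i : I) :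
    (fun y => Function.update s x a y i) = Function.update (fun y => s y i) x (a i) := by
  funext y
  by_cases hy : y = x
  · subst hy; simp
  · simp [hy]

/-- If the values of `φ` in the ultraproduct are the limits of those in the factors, then so are
the sets of values that `φ` takes as the variable `x` ranges over the domain. -/
theorem eventually_valueSet_eq (φ : Formula S) (x : ℕ) (s : ℕ → ∀ i, (A i).Dom)
    (ih : ∀ s : ℕ → ∀ i, (A i).Dom,
      ∀ᶠ i in U, (A i).val φ (fun y => s y i) = (ultraproduct U A).val φ s) :
    ∀ᶠ i in U, {c | ∃ a, c = (A i).val φ (Function.update (fun y => s y i) x a)} =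
      {c | ∃ a : ∀ i, (A i).Dom, c = (ultraproduct U A).val φ (Function.update s x a)} := by
  -- `Set Four` is finite too, so the value sets are themselves eventually constant.
  obtain ⟨X, hX⟩ := exists_eventually_eq_of_finite U
    fun i => {c | ∃ a, c = (A i).val φ (Function.update (fun y => s y i) x a)}
  suffices h : X =
      {c | ∃ a : ∀ i, (A i).Dom, c = (ultraproduct U A).val φ (Function.update s x a)} by
    exact h ▸ hX
  ext c
  constructor
  · intro hc
    -- Witnesses for `c` are glued into one point of the product; where the value set is not `X`,
    -- any element serves.
    have hex : ∀ i, ∃ a : (A i).Dom,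
        {c | ∃ a, c = (A i).val φ (Function.update (fun y => s y i) x a)} = X →
          c = (A i).val φ (Function.update (fun y => s y i) x a) := by
      intro i
      by_cases hi : {c | ∃ a, c = (A i).val φ (Function.update (fun y => s y i) x a)} = X
      · obtain ⟨a, ha⟩ : c ∈ {c | ∃ a, c = (A i).val φ (Function.update (fun y => s y i) x a)} :=
          hi ▸ hc
        exact ⟨a, fun _ => ha⟩
      · exact ⟨(A i).nonempty.some, fun h => absurd h hi⟩
    choose a ha using hex
    -- The value in the ultraproduct does not depend on `i`, so one good index suffices.
    obtain ⟨i, hi, hv⟩ := (hX.and (ih (Function.update s x a))).exists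
    rw [update_apply_coord] at hv
    exact ⟨a, (ha i hi).trans hv⟩
  · rintro ⟨a, rfl⟩
    obtain ⟨i, hi, hv⟩ := (hX.and (ih (Function.update s x a))).exists
    rw [update_apply_coord] at hv
    rw [← hi]
    exact ⟨a i, hv.symm⟩

/-- **Łoś's theorem**: the value of a formula in an ultraproduct is the limit of its values in the
factors. -/
theorem eventually_val_eq_val_ultraproduct (φ : Formula S) (s : ℕ → ∀ i, (A i).Dom) :
    ∀ᶠ i in U, (A i).val φ (fun x => s x i) = (ultraproduct U A).val φ s := by
  induction φ generalizing s with
  | pred P ts =>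
    filter_upwards [eventually_eq_ultraLim U fun i =>
      (A i).pred P fun k => (ultraproduct U A).termVal s (ts k) i] with i hi
    simp only [val, ← termVal_ultraproduct U A s]
    exact hi
  | neg φ ih => filter_upwards [ih s] with i hi using by simp only [val, hi]
  | cons φ ih => filter_upwards [ih s] with i hi using by simp only [val, hi]
  | and φ ψ ih₁ ih₂ =>
    filter_upwards [ih₁ s, ih₂ s] with i h₁ h₂ using by simp only [val, h₁, h₂]
  | or φ ψ ih₁ ih₂ =>
    filter_upwards [ih₁ s, ih₂ s] with i h₁ h₂ using by simp only [val, h₁, h₂]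
  | imp φ ψ ih₁ ih₂ =>
    filter_upwards [ih₁ s, ih₂ s] with i h₁ h₂ using by simp only [val, h₁, h₂]
  | all x φ ih =>
    filter_upwards [eventually_valueSet_eq U A φ x s ih] with i hi
    exact congrArg sInf hi
  | ex x φ ih =>
    filter_upwards [eventually_valueSet_eq U A φ x s ih] with i hi
    exact congrArg sSup hi

theorem satisfies_ultraproduct_iff (φ : Formula S) (s : ℕ → ∀ i, (A i).Dom) :
    (ultraproduct U A).Satisfies s φ ↔ ∀ᶠ i in U, (A i).Satisfies (fun x => s x i) φ := by
  have h := eventually_val_eq_val_ultraproduct U A φ s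
  constructor
  · intro hs
    filter_upwards [h] with i hi
    exact (congrArg (· ∈ Four.designated) hi).mpr hs
  · intro hs
    obtain ⟨i, hi, hv⟩ := (hs.and h).exists
    exact (congrArg (· ∈ Four.designated) hv).mp hi

end Ultraproduct

end Structure

end QBD2

theorem mainTheorem5 (S : QBD2.Signature.{u}) (Δ : Set (QBD2.Formula S)) (φ : QBD2.Formula S)
    (h : QBD2.Entails.{u, w} Δ φ) :
    ∃ Δ₀ : Set (QBD2.Formula S), Δ₀.Finite ∧ Δ₀ ⊆ Δ ∧ QBD2.Entails.{u, w} Δ₀ φ := by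
  by_contra hcon
  have hctr : ∀ F : Finset Δ, ∃ A : QBD2.Structure.{u, max u w} S,
      (∀ γ ∈ F, A.IsModel γ) ∧ ∃ s, ¬ A.Satisfies s φ := by
    intro F
    by_contra hF
    refine hcon ⟨Subtype.val '' (F : Set Δ), F.finite_toSet.image _, by simp, ?_⟩
    intro A hA s
    by_contra hs
    exact hF ⟨A, fun γ hγ => hA γ ⟨γ, hγ, rfl⟩, s, hs⟩
  choose A hA s hs using hctr
  -- Refining `atTop` puts every cone `{F | γ ∈ F}` in `U`. The index type lies in universe `u`, so
  -- the product domain stays in `max u w`.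
  let U : Ultrafilter (Finset Δ) := Ultrafilter.of Filter.atTop
  have hφ := h (QBD2.Structure.ultraproduct U A) (fun γ hγ t => by
    refine (QBD2.Structure.satisfies_ultraproduct_iff U A γ t).mpr ?_
    have hev : ∀ᶠ F : Finset Δ in Filter.atTop, {⟨γ, hγ⟩} ≤ F := Filter.eventually_ge_atTop _
    filter_upwards [Ultrafilter.of_le Filter.atTop hev] with F hF
    exact hA F ⟨γ, hγ⟩ (Finset.singleton_subset_iff.mp hF) _) (fun x F => s F x)
  obtain ⟨F, hF⟩ := ((QBD2.Structure.satisfies_ultraproduct_iff U A φ _).mp hφ).exists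
  exact hs F hF
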